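/- Let $\mathbb D$ be the open unit disc of $\mathbb C$ and $H(\mathbb D)$ the space of holomorphic functions on $\mathbb D$. A weight on $\mathbb D$ is a function $v:\mathbb D\to(0,\infty)$ that is continuous, radial ($v(z)=v(|z|)$), decreasing (in the wide sense) with respect to $|z|$, and satisfies $\lim_{|z|\to1^-}v(z)=0$. For a weight $v$ let $$H_v^\infty=\{f\in H(\mathbb D):\ \|f\|_v:=\sup_{z\in\mathbb D}v(z)|f(z)|<\infty\},\qquad H_v^0=\{f\in H_v^\infty:\ \lim_{|z|\to1^-}v(z)|f(z)|=0\},$$ both with the norm $\|\cdot\|_v$. Let $\mu$ be a positive finite Borel measure on $[0,1)$ with moments $\mu_n=\int_{[0,1)}t^n\,d\mu(t)$, $n\ge0$, and for $f(z)=\sum_{n\ge0}a_nz^n\in H(\mathbb D)$ put $$C_\mu(f)(z)=\sum_{n=0}^\infty\mu_n\Big(\sum_{k=0}^na_k\Big)z^n,\qquad z\in\mathbb D.$$ Let $v,w$ be weights on $\mathbb D$. The following conditions are equivalent: (i) $C_\mu$ maps $H_v^\infty$ into $H_w^\infty$, $C_\mu:H_v^\infty\to H_w^\infty$ is continuous,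 and $C_\mu(1)=\sum_{n=0}^\infty\mu_nz^n\in H_w^0$; (ii) $C_\mu$ maps $H_v^0$ into $H_w^0$ and $C_\mu:H_v^0\to H_w^0$ is continuous. If these conditions hold, then the bitranspose $C_\mu^{**}:(H_v^0)^{**}\to(H_w^0)^{**}$ of $C_\mu:H_v^0\to H_w^0$ coincides with $C_\mu:H_v^\infty\to H_w^\infty$ under the canonical isometric isomorphisms $J_u:(H_u^0)^{**}\to H_u^\infty$, $(J_u\Phi)(z)=\Phi(\delta_z)$ for $u\in\{v,w\}$, where $\delta_z\in(H_u^0)^*$ is the evaluation $f\mapsto f(z)$; that is, these maps $J_u$ are well-defined surjective linear isometries and $J_w\circ C_\mu^{**}=C_\mu\circ J_v$. Moreover, $$\|C_\mu\|_{\mathcal L(H_v^\infty,H_w^\infty)}=\|C_\mu\|_{\mathcal L(H_v^0,H_w^0)}.$$ -/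

import Mathlib

noncomputable section

namespace CesaroType

open Complex MeasureTheory Filter Topology
open scoped UnitDisc

/-- A weight on the open unit disc: a positive, radial, continuous function that is decreasing with
respect to `|z|` (in the wide sense) and tends to `0` as `|z| → 1⁻`. -/
structure Weight where
  toFun : 𝔻 → ℝ
  pos : ∀ z, 0 < toFun z
  radial : ∀ z ζ : 𝔻, ‖(z : ℂ)‖ = ‖(ζ : ℂ)‖ → toFun z = toFun ζ
  continuous : Continuous toFun
  decreasing : ∀ z ζ : 𝔻, ‖(z : ℂ)‖ ≤ ‖(ζ : ℂ)‖ → toFun ζ ≤ toFun z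
  tendsto_zero : Tendsto toFun (comap (fun z : 𝔻 => ‖(z : ℂ)‖) (𝓝[<] 1)) (𝓝 0)

instance : CoeFun Weight (fun _ => 𝔻 → ℝ) := ⟨Weight.toFun⟩

/-- Extension by zero of a function on the disc to the plane (used only to speak about complex
derivatives; only the values on the open disc matter). -/
def discExtend (f : 𝔻 → ℂ) (z : ℂ) : ℂ :=
  if hz : ‖z‖ < 1 then f (UnitDisc.mk z hz) else 0

/-- `f ∈ H(𝔻)`: the function `f` is holomorphic on the open unit disc. -/
def Holomorphic (f : 𝔻 → ℂ) : Prop :=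
  DifferentiableOn ℂ (discExtend f) (Metric.ball 0 1)

/-- The `n`-th Taylor coefficient at `0` of a function on the disc. -/
def taylorCoeff (f : 𝔻 → ℂ) (n : ℕ) : ℂ :=
  iteratedDeriv n (discExtend f) 0 / (n.factorial : ℂ)

/-- The `n`-th moment `∫ tⁿ dμ(t)` of a measure on `[0,1)`. -/
def moment (μ : Measure (Set.Ico (0 : ℝ) 1)) (n : ℕ) : ℝ :=
  ∫ t, (t : ℝ) ^ n ∂μ

/-- The Cesàro-type operator: for `f(z) = ∑ aₙ zⁿ` in `H(𝔻)`,
`C_μ(f)(z) = ∑ₙ μₙ (a₀ + ⋯ + aₙ) zⁿ`. -/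
def cesaro (μ : Measure (Set.Ico (0 : ℝ) 1)) (f : 𝔻 → ℂ) (z : 𝔻) : ℂ :=
  ∑' n : ℕ, (moment μ n : ℂ) * (∑ k ∈ Finset.range (n + 1), taylorCoeff f k) * (z : ℂ) ^ n

lemma discExtend_coe (f : 𝔻 → ℂ) (z : 𝔻) : discExtend f z = f z := by
  have h : ‖(z : ℂ)‖ < 1 := z.norm_lt_one
  simp only [discExtend, h, dif_pos]
  rfl

lemma discExtend_add (f g : 𝔻 → ℂ) : discExtend (f + g) = discExtend f + discExtend g := by
  ext z
  by_cases h : ‖z‖ < 1 <;> simp [discExtend, h]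

lemma discExtend_smul (c : ℂ) (f : 𝔻 → ℂ) : discExtend (c • f) = c • discExtend f := by
  ext z
  by_cases h : ‖z‖ < 1 <;> simp [discExtend, h]

lemma discExtend_zero : discExtend 0 = 0 := by
  ext z
  by_cases h : ‖z‖ < 1 <;> simp [discExtend, h]

/-- A holomorphic function on the disc is the sum of its Taylor series. -/
lemma hasSum_taylorCoeff {f : 𝔻 → ℂ} (hf : Holomorphic f) (z : 𝔻) :
    HasSum (fun n => taylorCoeff f n * (z : ℂ) ^ n) (f z) := by
  have hz : (z : ℂ) ∈ Metric.ball (0 : ℂ) 1 := mem_ball_zero_iff.2 z.norm_lt_one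
  have := Complex.hasSum_taylorSeries_on_ball hf hz
  rw [discExtend_coe] at this
  have e : (fun n => taylorCoeff f n * (z : ℂ) ^ n) = fun n : ℕ =>
      (n.factorial : ℂ)⁻¹ • ((z : ℂ) - 0) ^ n • iteratedDeriv n (discExtend f) 0 := by
    funext n
    simp only [taylorCoeff, sub_zero, smul_eq_mul, div_eq_mul_inv]
    ring
  rw [e]
  exact this

/-- The series that defines the Cesàro-type operator on `H(𝔻)` converges absolutely. -/
lemma summable_cesaro (μ : Measure (Set.Ico (0 : ℝ) 1)) [IsFiniteMeasure μ]
    {f : 𝔻 → ℂ} (hf : Holomorphic f) (z : 𝔻) :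
    Summable fun n : ℕ =>
      ‖(moment μ n : ℂ) * (∑ k ∈ Finset.range (n + 1), taylorCoeff f k) * (z : ℂ) ^ n‖ := by
  have h1 := (hasSum_taylorCoeff hf z).summable.norm
  have h2 : Summable fun n : ℕ => ‖(z : ℂ) ^ n‖ := by
    simpa using summable_geometric_of_lt_one (norm_nonneg _) z.norm_lt_one
  have h3 := summable_norm_sum_mul_range_of_summable_norm h1 h2
  refine Summable.of_nonneg_of_le (fun _ => norm_nonneg _) (fun n => ?_)
    (h3.mul_left (μ.real Set.univ))
  have e : ∑ k ∈ Finset.range (n + 1), taylorCoeff f k * (z : ℂ) ^ k * (z : ℂ) ^ (n - k)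
      = (∑ k ∈ Finset.range (n + 1), taylorCoeff f k) * (z : ℂ) ^ n := by
    rw [Finset.sum_mul]
    refine Finset.sum_congr rfl fun k hk => ?_
    rw [mul_assoc, ← pow_add, Nat.add_sub_cancel' (by simpa [Nat.lt_succ_iff] using hk)]
  rw [e, mul_assoc, norm_mul]
  refine mul_le_mul_of_nonneg_right ?_ (norm_nonneg _)
  have := norm_integral_le_of_norm_le_const (μ := μ) (f := fun t => (t : ℝ) ^ n) (C := 1)
    (ae_of_all _ fun t => by
      rw [norm_pow, Real.norm_of_nonneg t.2.1]
      exact pow_le_one₀ t.2.1 t.2.2.le)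
  simpa [moment] using this

/-- The underlying vector space of `H_v^∞`: the holomorphic `f` on the disc with
`sup_z v(z)|f(z)| < ∞`. -/
def growthSubmodule (v : Weight) : Submodule ℂ (𝔻 → ℂ) where
  carrier := {f | Holomorphic f ∧ BddAbove (Set.range fun z => v z * ‖f z‖)}
  zero_mem' := by
    refine ⟨?_, 0, ?_⟩
    · rw [Holomorphic, discExtend_zero]
      exact differentiableOn_const (0 : ℂ)
    · rintro _ ⟨z, rfl⟩
      simp
  add_mem' := by
    rintro f g ⟨hf, A, hA⟩ ⟨hg, B, hB⟩
    refine ⟨?_, A + B, ?_⟩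
    · simpa only [Holomorphic, discExtend_add] using hf.add hg
    · rintro _ ⟨z, rfl⟩
      have h1 := hA ⟨z, rfl⟩
      have h2 := hB ⟨z, rfl⟩
      have h3 := mul_le_mul_of_nonneg_left (norm_add_le (f z) (g z)) (v.pos z).le
      simp only [Pi.add_apply] at h1 h2 h3 ⊢
      linarith
  smul_mem' := by
    rintro c f ⟨hf, A, hA⟩
    refine ⟨?_, ‖c‖ * A, ?_⟩
    · simpa only [Holomorphic, discExtend_smul] using hf.const_smul c
    · rintro _ ⟨z, rfl⟩
      have h1 := mul_le_mul_of_nonneg_left (hA ⟨z, rfl⟩) (norm_nonneg c)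
      simp only [Pi.smul_apply, norm_smul] at h1 ⊢
      linarith

/-- The space `H_v^∞`, as a type of its own so that it carries the topology of the weighted
sup-norm and not the one of pointwise convergence. -/
def GrowthSpace (v : Weight) : Type := growthSubmodule v

namespace GrowthSpace

variable {v : Weight}

instance : AddCommGroup (GrowthSpace v) := inferInstanceAs (AddCommGroup (growthSubmodule v))

instance : Module ℂ (GrowthSpace v) := inferInstanceAs (Module ℂ (growthSubmodule v))

instance : CoeFun (GrowthSpace v) (fun _ => 𝔻 → ℂ) := ⟨Subtype.val⟩

lemma ext' {f g : GrowthSpace v} (h : ∀ z, f z = g z) : f = g := Subtype.ext (funext h)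

lemma zero_apply (z : 𝔻) : (0 : GrowthSpace v) z = 0 := rfl

lemma add_apply (f g : GrowthSpace v) (z : 𝔻) : (f + g) z = f z + g z := rfl

lemma smul_apply (c : ℂ) (f : GrowthSpace v) (z : 𝔻) : (c • f) z = c * f z := rfl

/-- `‖f‖_v = sup_z v(z)|f(z)|`. -/
instance : Norm (GrowthSpace v) := ⟨fun f => ⨆ z : 𝔻, v z * ‖f z‖⟩

lemma norm_def (f : GrowthSpace v) : ‖f‖ = ⨆ z : 𝔻, v z * ‖f z‖ := rfl

lemma le_norm (f : GrowthSpace v) (z : 𝔻) : v z * ‖f z‖ ≤ ‖f‖ := le_ciSup f.2.2 z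

lemma norm_core : NormedSpace.Core ℂ (GrowthSpace v) where
  norm_nonneg f := Real.iSup_nonneg fun z => mul_nonneg (v.pos z).le (norm_nonneg _)
  norm_smul c f := by
    rw [norm_def, norm_def, Real.mul_iSup_of_nonneg (norm_nonneg c)]
    refine iSup_congr fun z => ?_
    rw [smul_apply, norm_mul]
    ring
  norm_triangle f g := by
    refine ciSup_le fun z => ?_
    have h1 := le_norm f z
    have h2 := le_norm g z
    have h3 := mul_le_mul_of_nonneg_left (norm_add_le (f z) (g z)) (v.pos z).le
    rw [add_apply]
    linarith
  norm_eq_zero_iff f := by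
    constructor
    · intro h
      refine ext' fun z => ?_
      have h1 := le_norm f z
      rw [h] at h1
      have h2 : ‖f z‖ ≤ 0 := by
        by_contra hc
        exact absurd h1 (not_le.2 (mul_pos (v.pos z) (not_le.1 hc)))
      simpa [zero_apply] using h2
    · rintro rfl
      simp [norm_def, zero_apply]

instance : NormedAddCommGroup (GrowthSpace v) := NormedAddCommGroup.ofCore norm_core

instance : NormedSpace ℂ (GrowthSpace v) := NormedSpace.ofCore norm_core

end GrowthSpace

/-- `v(z)|f(z)| → 0` as `|z| → 1⁻`. -/
def VanishesAtBoundary (v : Weight) (f : 𝔻 → ℂ) : Prop :=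
  Tendsto (fun z : 𝔻 => v z * ‖f z‖) (comap (fun z : 𝔻 => ‖(z : ℂ)‖) (𝓝[<] 1)) (𝓝 0)

/-- The subspace of the `f ∈ H_v^∞` with `v(z)|f(z)| → 0` as `|z| → 1⁻`. -/
def littleSubmodule (v : Weight) : Submodule ℂ (GrowthSpace v) where
  carrier := {f | VanishesAtBoundary v f}
  zero_mem' := by
    simpa [VanishesAtBoundary, GrowthSpace.zero_apply] using tendsto_const_nhds
  add_mem' := by
    intro f g hf hg
    refine squeeze_zero (fun z => mul_nonneg (v.pos z).le (norm_nonneg _)) (fun z => ?_)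
      (by simpa using Tendsto.add hf hg)
    rw [← mul_add]
    exact mul_le_mul_of_nonneg_left (norm_add_le (f z) (g z)) (v.pos z).le
  smul_mem' := by
    intro c f hf
    have h := Tendsto.const_mul ‖c‖ hf
    rw [mul_zero] at h
    refine h.congr fun z => ?_
    rw [GrowthSpace.smul_apply, norm_mul]
    ring

/-- The space `H_v^0`, with the norm of `H_v^∞`. -/
def LittleGrowthSpace (v : Weight) : Type := littleSubmodule v

namespace LittleGrowthSpace

variable {v : Weight}

instance : NormedAddCommGroup (LittleGrowthSpace v) :=
  inferInstanceAs (NormedAddCommGroup (littleSubmodule v))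

instance : NormedSpace ℂ (LittleGrowthSpace v) :=
  inferInstanceAs (NormedSpace ℂ (littleSubmodule v))

/-- The inclusion `H_v^0 ⊆ H_v^∞`. -/
def toGrowth (f : LittleGrowthSpace v) : GrowthSpace v := Subtype.val f

instance : CoeFun (LittleGrowthSpace v) (fun _ => 𝔻 → ℂ) := ⟨fun f => f.toGrowth.1⟩

lemma norm_def (f : LittleGrowthSpace v) : ‖f‖ = ⨆ z : 𝔻, v z * ‖f z‖ := rfl

end LittleGrowthSpace

/-- The point evaluation `δ_z : f ↦ f(z)` as an element of the dual of `H_v^0`. -/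
def pointEval (v : Weight) (z : 𝔻) : StrongDual ℂ (LittleGrowthSpace v) :=
  LinearMap.mkContinuous
    { toFun := fun f => f z
      map_add' := fun _ _ => rfl
      map_smul' := fun _ _ => rfl }
    (v z)⁻¹ fun f => by
      rw [inv_mul_eq_div, le_div_iff₀ (v.pos z), mul_comm]
      exact GrowthSpace.le_norm f.toGrowth z

/-- The transpose `φ ↦ φ ∘ S` of a continuous linear map between normed spaces. -/
def transpose {E F : Type*} [NormedAddCommGroup E] [NormedSpace ℂ E] [NormedAddCommGroup F]
    [NormedSpace ℂ F] (S : E →L[ℂ] F) : StrongDual ℂ F →L[ℂ] StrongDual ℂ E :=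
  ContinuousLinearMap.precomp ℂ S

/-- The bitranspose `S** : E** → F**`. -/
def bitranspose {E F : Type*} [NormedAddCommGroup E] [NormedSpace ℂ E] [NormedAddCommGroup F]
    [NormedSpace ℂ F] (S : E →L[ℂ] F) :
    StrongDual ℂ (StrongDual ℂ E) →L[ℂ] StrongDual ℂ (StrongDual ℂ F) :=
  transpose (transpose S)

/-- `J` is the canonical isometric isomorphism from the bidual of `H_v^0` onto `H_v^∞`: it sends `Φ`
to the function `z ↦ Φ(δ_z)` (in particular it is unique, and it sends the image in the bidual of
`f ∈ H_v^0` to `f`). -/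
def IsCanonical {v : Weight}
    (J : StrongDual ℂ (StrongDual ℂ (LittleGrowthSpace v)) ≃ₗᵢ[ℂ] GrowthSpace v) : Prop :=
  ∀ Φ z, J Φ z = Φ (pointEval v z)

/-- The continuous linear operator `T : H_v^∞ → H_w^∞` is `C_μ`. -/
def IsCesaroBig (μ : Measure (Set.Ico (0 : ℝ) 1)) {v w : Weight}
    (T : GrowthSpace v →L[ℂ] GrowthSpace w) : Prop :=
  ∀ f z, T f z = cesaro μ f z

/-- The continuous linear operator `S : H_v^0 → H_w^0` is `C_μ`. -/
def IsCesaroLittle (μ : Measure (Set.Ico (0 : ℝ) 1)) {v w : Weight}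
    (S : LittleGrowthSpace v →L[ℂ] LittleGrowthSpace w) : Prop :=
  ∀ f z, S f z = cesaro μ f z

end CesaroType

end

noncomputable section

namespace CesaroType

open Complex MeasureTheory Filter Topology
open scoped UnitDisc

/-! ### Power series on the disc -/

/-! The key is the duality (H_v^0)** = H_v^∞, obtained from the dilations D_ρ F = F(ρ ·), which are
contractions from H_v^∞ into H_v^0. A gliding hump argument (`exists_norm_lt_two_of_hump`) shows
that a functional φ on H_v^0 is small on bounded families that are small on a large compact disc.
Since D_ρ F → F uniformly on compact discs, φ(D_ρ F) is Cauchy as ρ → 1, uniformly for bounded F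
(`eventually_norm_apply_dilate_sub_le`). The limits define a preimage of F under J_v. They also give
φ ∘ D_ρ → φ in the dual norm; as φ ∘ D_ρ is a norm-convergent series of coefficient functionals, Φ
is recovered from J_v Φ, and J_v is isometric.

If C_μ acts on H_v^0, then δ_z ∘ C_μ is again a norm-convergent series of coefficient functionals
(`hasSum_pointEval_comp`). Applying Φ termwise identifies the bitranspose with C_μ on H_v^∞, which
gives (ii) ⇒ (i) and the equality of norms.

For (i) ⇒ (ii), C_μ(z^k) is C_μ(1) minus a polynomial, hence lies in H_w^0; monomials span a dense
subspace of H_v^0, and H_w^0 is closed in H_w^∞. -/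

lemma exists_norm_lt (z : 𝔻) : ∃ s : 𝔻, ‖(z : ℂ)‖ < ‖(s : ℂ)‖ := by
  have h := z.norm_lt_one
  have h0 := norm_nonneg (z : ℂ)
  have e : ‖(((1 + ‖(z : ℂ)‖) / 2 : ℝ) : ℂ)‖ = (1 + ‖(z : ℂ)‖) / 2 := by
    rw [Complex.norm_real, Real.norm_of_nonneg (by linarith)]
  refine ⟨UnitDisc.mk (((1 + ‖(z : ℂ)‖) / 2 : ℝ) : ℂ) (by rw [e]; linarith), ?_⟩
  rw [UnitDisc.coe_mk, e]
  linarith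

/-- Summability at each real point r < 1 is absolute, which forces the radius of convergence to be
at least 1. -/
lemma hasFPowerSeriesOnBall_of_hasSum {f : 𝔻 → ℂ} {c : ℕ → ℂ}
    (h : ∀ z : 𝔻, HasSum (fun n => c n * (z : ℂ) ^ n) (f z)) :
    HasFPowerSeriesOnBall (discExtend f) (FormalMultilinearSeries.ofScalars ℂ c) 0 1 where
  r_le := by
    refine ENNReal.le_of_forall_nnreal_lt fun r hr => ?_
    have hr1 : (r : ℝ) < 1 := by exact_mod_cast hr
    refine FormalMultilinearSeries.le_radius_of_summable _ ?_
    have := (h (UnitDisc.mk (r : ℂ) (by simpa using hr1))).summable.norm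
    simpa using this
  r_pos := one_pos
  hasSum := by
    intro y hy
    have hy1 : ‖y‖ < 1 := by
      have := Metric.mem_eball.1 hy
      rw [edist_zero_right, enorm_eq_nnnorm] at this
      exact_mod_cast this
    have := h (UnitDisc.mk y hy1)
    rw [← discExtend_coe f, UnitDisc.coe_mk] at this
    simpa [mul_comm] using this

lemma holomorphic_of_hasSum {f : 𝔻 → ℂ} {c : ℕ → ℂ}
    (h : ∀ z : 𝔻, HasSum (fun n => c n * (z : ℂ) ^ n) (f z)) : Holomorphic f := by
  have := (hasFPowerSeriesOnBall_of_hasSum h).differentiableOn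
  rwa [← ENNReal.ofReal_one, Metric.eball_ofReal] at this

lemma taylorCoeff_eq_of_hasSum {f : 𝔻 → ℂ} {c : ℕ → ℂ}
    (h : ∀ z : 𝔻, HasSum (fun n => c n * (z : ℂ) ^ n) (f z)) (n : ℕ) : taylorCoeff f n = c n := by
  have := (hasFPowerSeriesOnBall_of_hasSum h).factorial_smul 1 n
  rw [iteratedFDeriv_apply_eq_iteratedDeriv_mul_prod, Finset.prod_const_one, one_smul,
    FormalMultilinearSeries.ofScalars_apply_eq] at this
  rw [taylorCoeff, ← this, div_eq_iff (by exact_mod_cast n.factorial_ne_zero)]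
  simp [mul_comm]

/-- Cauchy's estimate on the circle through s. -/
lemma norm_taylorCoeff_mul_pow_le {f : 𝔻 → ℂ} (hf : Holomorphic f) {s : 𝔻}
    (hs : 0 < ‖(s : ℂ)‖) {C : ℝ} (hC : ∀ z : 𝔻, ‖(z : ℂ)‖ = ‖(s : ℂ)‖ → ‖f z‖ ≤ C) (n : ℕ) :
    ‖taylorCoeff f n‖ * ‖(s : ℂ)‖ ^ n ≤ C := by
  have hd : DiffContOnCl ℂ (discExtend f) (Metric.ball 0 ‖(s : ℂ)‖) :=
    DifferentiableOn.diffContOnCl_ball hf (Metric.closedBall_subset_ball s.norm_lt_one)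
  have := norm_iteratedDeriv_le_of_forall_mem_sphere_norm_le (C := C) n hs hd (by
    intro z hz
    have hz' : ‖z‖ = ‖(s : ℂ)‖ := by simpa using hz
    have h1 : ‖z‖ < 1 := hz' ▸ s.norm_lt_one
    have := hC (UnitDisc.mk z h1) hz'
    rwa [← discExtend_coe f, UnitDisc.coe_mk] at this)
  have hp := pow_pos hs n
  have hq : (0 : ℝ) < n.factorial := by exact_mod_cast n.factorial_pos
  rw [le_div_iff₀ hp] at this
  rw [taylorCoeff, norm_div, Complex.norm_natCast, div_mul_eq_mul_div, div_le_iff₀ hq]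
  linarith

/-! ### Basic facts on the weighted spaces -/

lemma Weight.le_apply_zero (v : Weight) (z : 𝔻) : v z ≤ v 0 :=
  v.decreasing 0 z (by simp)

lemma norm_coe_mul_le_left (ρ z : 𝔻) : ‖((ρ * z : 𝔻) : ℂ)‖ ≤ ‖(ρ : ℂ)‖ := by
  rw [UnitDisc.coe_mul, norm_mul]
  exact mul_le_of_le_one_right (norm_nonneg _) z.norm_lt_one.le

lemma norm_coe_mul_le_right (ρ z : 𝔻) : ‖((ρ * z : 𝔻) : ℂ)‖ ≤ ‖(z : ℂ)‖ := by
  rw [mul_comm]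
  exact norm_coe_mul_le_left z ρ

lemma vanishesAtBoundary_of_bounded (v : Weight) {f : 𝔻 → ℂ} {C : ℝ} (hC : ∀ z, ‖f z‖ ≤ C) :
    VanishesAtBoundary v f := by
  refine squeeze_zero (fun z => mul_nonneg (v.pos z).le (norm_nonneg _))
    (fun z => mul_le_mul_of_nonneg_left (hC z) (v.pos z).le) ?_
  simpa using v.tendsto_zero.mul_const C

lemma VanishesAtBoundary.exists_lt {v : Weight} {f : 𝔻 → ℂ} (hf : VanishesAtBoundary v f)
    {ε : ℝ} (hε : 0 < ε) :
    ∃ R : 𝔻, ∀ z : 𝔻, ‖(R : ℂ)‖ < ‖(z : ℂ)‖ → v z * ‖f z‖ < ε := by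
  have h := hf.eventually (gt_mem_nhds hε)
  rw [eventually_comap] at h
  obtain ⟨r, hr, H⟩ := (mem_nhdsLT_iff_exists_Ioo_subset' (show (-1 : ℝ) < 1 by norm_num)).1 h
  have hm : max r 0 < 1 := max_lt hr one_pos
  have e : ‖((max r 0 : ℝ) : ℂ)‖ = max r 0 := by
    rw [Complex.norm_real, Real.norm_of_nonneg (le_max_right _ _)]
  refine ⟨UnitDisc.mk ((max r 0 : ℝ) : ℂ) (by rwa [e]), fun z hz => ?_⟩
  rw [UnitDisc.coe_mk, e] at hz
  exact H ⟨(le_max_left _ _).trans_lt hz, z.norm_lt_one⟩ z rfl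

/-! ### Coefficient functionals on H_v^∞ -/

namespace GrowthSpace

variable {v : Weight}

lemma norm_le {f : GrowthSpace v} {C : ℝ} (h : ∀ z, v z * ‖f z‖ ≤ C) : ‖f‖ ≤ C := ciSup_le h

lemma sub_apply (f g : GrowthSpace v) (z : 𝔻) : (f - g) z = f z - g z := rfl

lemma hasSum (f : GrowthSpace v) (z : 𝔻) :
    HasSum (fun n => taylorCoeff f n * (z : ℂ) ^ n) (f z) :=
  hasSum_taylorCoeff f.2.1 z

lemma norm_apply_le (f : GrowthSpace v) (z : 𝔻) : ‖f z‖ ≤ (v z)⁻¹ * ‖f‖ := by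
  rw [inv_mul_eq_div, le_div_iff₀ (v.pos z), mul_comm]
  exact f.le_norm z

lemma norm_taylorCoeff_mul_pow_le (f : GrowthSpace v) {s : 𝔻} (hs : 0 < ‖(s : ℂ)‖) (n : ℕ) :
    ‖taylorCoeff f n‖ * ‖(s : ℂ)‖ ^ n ≤ (v s)⁻¹ * ‖f‖ :=
  CesaroType.norm_taylorCoeff_mul_pow_le f.2.1 hs
    (fun z hz => by rw [← v.radial z s hz]; exact f.norm_apply_le z) n

variable (v) in
/-- The `n`-th Taylor coefficient as a continuous functional on `H_v^∞`. -/
def coeff (n : ℕ) : StrongDual ℂ (GrowthSpace v) :=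
  LinearMap.mkContinuousOfExistsBound
    { toFun := fun f => taylorCoeff f n
      map_add' := fun f g => taylorCoeff_eq_of_hasSum (c := fun n => taylorCoeff f n +
        taylorCoeff g n) (fun z => by simpa only [add_mul, add_apply] using (f.hasSum z).add (g.hasSum z)) n
      map_smul' := fun c f => taylorCoeff_eq_of_hasSum (c := fun n => c * taylorCoeff f n)
        (fun z => by simpa only [mul_assoc, smul_apply] using (f.hasSum z).mul_left c) n } (by
    obtain ⟨s, hs⟩ := exists_norm_lt 0
    have hs : 0 < ‖(s : ℂ)‖ := by simpa using hs
    refine ⟨(v s)⁻¹ / ‖(s : ℂ)‖ ^ n, fun f => ?_⟩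
    rw [div_mul_eq_mul_div, le_div_iff₀ (pow_pos hs n)]
    exact f.norm_taylorCoeff_mul_pow_le hs n)

lemma coeff_apply (n : ℕ) (f : GrowthSpace v) : coeff v n f = taylorCoeff f n := rfl

lemma norm_coeff_mul_pow_le {s : 𝔻} (hs : 0 < ‖(s : ℂ)‖) (n : ℕ) :
    ‖coeff v n‖ * ‖(s : ℂ)‖ ^ n ≤ (v s)⁻¹ := by
  rw [← le_div_iff₀ (pow_pos hs n)]
  refine ContinuousLinearMap.opNorm_le_bound _
    (div_nonneg (inv_nonneg.2 (v.pos s).le) (pow_pos hs n).le) fun f => ?_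
  rw [div_mul_eq_mul_div, le_div_iff₀ (pow_pos hs n)]
  exact f.norm_taylorCoeff_mul_pow_le hs n

/-- Cauchy's estimate at a slightly larger radius gives a geometric majorant. This bound in the dual
norm is what makes Taylor expansions converge uniformly on bounded sets. -/
lemma summable_norm_coeff (z : 𝔻) : Summable fun n => ‖coeff v n‖ * ‖(z : ℂ)‖ ^ n := by
  obtain ⟨s, hs⟩ := exists_norm_lt z
  have hs0 : 0 < ‖(s : ℂ)‖ := (norm_nonneg _).trans_lt hs
  refine Summable.of_nonneg_of_le (fun n => by positivity) (fun n => ?_)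
    ((summable_geometric_of_lt_one (by positivity) ((div_lt_one hs0).2 hs)).mul_left (v s)⁻¹)
  have h := mul_le_mul_of_nonneg_right (norm_coeff_mul_pow_le (v := v) hs0 n)
    (by positivity : 0 ≤ (‖(z : ℂ)‖ / ‖(s : ℂ)‖) ^ n)
  rwa [mul_assoc, ← mul_pow, mul_div_cancel₀ _ hs0.ne'] at h

end GrowthSpace

/-! ### Coefficients, evaluations and monomials in H_v^0 -/

namespace LittleGrowthSpace

variable {v : Weight}

/-- The inclusion `H_v^0 ⊆ H_v^∞` as a linear isometry. -/
def inclusion (v : Weight) : LittleGrowthSpace v →ₗᵢ[ℂ] GrowthSpace v :=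
  (littleSubmodule v).subtypeₗᵢ

lemma ext' {f g : LittleGrowthSpace v} (h : ∀ z, f z = g z) : f = g :=
  Subtype.ext (GrowthSpace.ext' h)

lemma norm_le {f : LittleGrowthSpace v} {C : ℝ} (h : ∀ z, v z * ‖f z‖ ≤ C) : ‖f‖ ≤ C := ciSup_le h

lemma le_norm (f : LittleGrowthSpace v) (z : 𝔻) : v z * ‖f z‖ ≤ ‖f‖ := f.toGrowth.le_norm z

lemma exists_lt (f : LittleGrowthSpace v) {ε : ℝ} (hε : 0 < ε) :
    ∃ R : 𝔻, ∀ z : 𝔻, ‖(R : ℂ)‖ < ‖(z : ℂ)‖ → v z * ‖f z‖ < ε :=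
  VanishesAtBoundary.exists_lt f.2 hε

lemma add_apply (f g : LittleGrowthSpace v) (z : 𝔻) : (f + g) z = f z + g z := rfl

lemma sub_apply (f g : LittleGrowthSpace v) (z : 𝔻) : (f - g) z = f z - g z := rfl

lemma smul_apply (c : ℂ) (f : LittleGrowthSpace v) (z : 𝔻) : (c • f) z = c * f z := rfl

lemma pointEval_apply (z : 𝔻) (f : LittleGrowthSpace v) : pointEval v z f = f z := rfl

lemma hasSum (f : LittleGrowthSpace v) (z : 𝔻) :
    HasSum (fun n => taylorCoeff f n * (z : ℂ) ^ n) (f z) :=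
  f.toGrowth.hasSum z

/-- A bounded holomorphic function as an element of `H_v^0`. -/
def ofBounded (v : Weight) (f : 𝔻 → ℂ) (hf : Holomorphic f) (C : ℝ) (hC : ∀ z, ‖f z‖ ≤ C) :
    LittleGrowthSpace v :=
  ⟨⟨f, hf, v 0 * C, by
    rintro _ ⟨z, rfl⟩
    exact mul_le_mul (v.le_apply_zero z) (hC z) (norm_nonneg _) (v.pos 0).le⟩,
    vanishesAtBoundary_of_bounded v hC⟩

variable (v) in
/-- The `n`-th Taylor coefficient as a continuous functional on `H_v^0`. -/
def coeff (n : ℕ) : StrongDual ℂ (LittleGrowthSpace v) :=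
  (GrowthSpace.coeff v n).comp (inclusion v).toContinuousLinearMap

lemma coeff_apply (n : ℕ) (f : LittleGrowthSpace v) : coeff v n f = taylorCoeff f n := rfl

lemma norm_coeff_le (n : ℕ) : ‖coeff v n‖ ≤ ‖GrowthSpace.coeff v n‖ := by
  refine (ContinuousLinearMap.opNorm_comp_le _ _).trans ?_
  exact mul_le_of_le_one_right (norm_nonneg _) (inclusion v).norm_toContinuousLinearMap_le

lemma summable_norm_coeff (z : 𝔻) : Summable fun n => ‖coeff v n‖ * ‖(z : ℂ)‖ ^ n :=
  Summable.of_nonneg_of_le (fun n => by positivity)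
    (fun n => mul_le_mul_of_nonneg_right (norm_coeff_le n) (by positivity))
    (GrowthSpace.summable_norm_coeff z)

/-- Convergence is in the dual norm, so elements of the bidual may be applied term by term. -/
lemma hasSum_pointEval (z : 𝔻) : HasSum (fun n => (z : ℂ) ^ n • coeff v n) (pointEval v z) := by
  have hs : Summable fun n => (z : ℂ) ^ n • coeff v n := by
    refine Summable.of_norm ?_
    simpa only [norm_smul, norm_pow, mul_comm] using summable_norm_coeff (v := v) z
  convert hs.hasSum
  ext f
  have h1 := hs.hasSum.mapL (ContinuousLinearMap.apply ℂ ℂ f)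
  refine HasSum.unique ?_ h1
  simpa [mul_comm, coeff_apply, pointEval_apply] using f.hasSum z

lemma hasSum_pow (n : ℕ) (z : 𝔻) :
    HasSum (fun k => (Pi.single n 1 : ℕ → ℂ) k * (z : ℂ) ^ k) ((z : ℂ) ^ n) := by
  have := hasSum_single (f := fun k => (Pi.single n 1 : ℕ → ℂ) k * (z : ℂ) ^ k) n
    (fun k hk => by simp [hk])
  simpa using this

/-- The function `z ↦ z ^ n` as an element of `H_v^0`. -/
def monomial (v : Weight) (n : ℕ) : LittleGrowthSpace v :=
  ofBounded v (fun z => (z : ℂ) ^ n) (holomorphic_of_hasSum (hasSum_pow n)) 1 fun z => by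
    rw [norm_pow]
    exact pow_le_one₀ (norm_nonneg _) z.norm_lt_one.le

lemma monomial_apply (n : ℕ) (z : 𝔻) : monomial v n z = (z : ℂ) ^ n := rfl

lemma taylorCoeff_monomial (n k : ℕ) :
    taylorCoeff (monomial v n) k = (Pi.single n 1 : ℕ → ℂ) k :=
  taylorCoeff_eq_of_hasSum (hasSum_pow n) k

lemma norm_monomial_le (n : ℕ) : ‖monomial v n‖ ≤ v 0 := by
  refine norm_le fun z => ?_
  rw [monomial_apply, norm_pow]
  exact (mul_le_of_le_one_right (v.pos z).le
    (pow_le_one₀ (norm_nonneg _) z.norm_lt_one.le)).trans (v.le_apply_zero z)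

lemma sum_apply {ι : Type*} (s : Finset ι) (F : ι → LittleGrowthSpace v) (z : 𝔻) :
    (∑ i ∈ s, F i : LittleGrowthSpace v) z = ∑ i ∈ s, F i z :=
  map_sum (pointEval v z) F s

lemma hasSum_monomial {b : ℕ → ℂ} (hb : Summable fun n => ‖b n‖) {f : LittleGrowthSpace v}
    (hf : ∀ z : 𝔻, HasSum (fun n => b n * (z : ℂ) ^ n) (f z)) :
    HasSum (fun n => b n • monomial v n) f := by
  have h0 := (tendsto_tsum_compl_atTop_zero fun n => ‖b n‖).const_mul (v 0)
  rw [mul_zero] at h0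
  rw [HasSum]
  refine tendsto_iff_norm_sub_tendsto_zero.2 (squeeze_zero (fun _ => norm_nonneg _) (fun s => ?_) h0)
  rw [norm_sub_rev]
  refine norm_le fun z => ?_
  have hz : ∀ n, ‖b n * (z : ℂ) ^ n‖ ≤ ‖b n‖ := fun n => by
    rw [norm_mul, norm_pow]
    exact mul_le_of_le_one_right (norm_nonneg _) (pow_le_one₀ (norm_nonneg _) z.norm_lt_one.le)
  have e : (f - ∑ n ∈ s, b n • monomial v n) z = ∑' n : {n // n ∉ s}, b n * (z : ℂ) ^ (n : ℕ) := by
    rw [sub_apply, sum_apply, ← (hf z).tsum_eq, ← (hf z).summable.sum_add_tsum_subtype_compl s]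
    simp [smul_apply, monomial_apply]
  rw [e]
  refine mul_le_mul (v.le_apply_zero z) ?_ (norm_nonneg _) (v.pos 0).le
  exact tsum_of_norm_bounded (hb.subtype _).hasSum fun n => hz n

end LittleGrowthSpace

/-! ### Dilations -/

section Dilation

variable {v : Weight}

lemma GrowthSpace.hasSum_dilate (ρ : 𝔻) (F : GrowthSpace v) (z : 𝔻) :
    HasSum (fun n => taylorCoeff F n * (ρ : ℂ) ^ n * (z : ℂ) ^ n) (F (ρ * z)) := by
  simpa [mul_pow, mul_assoc] using F.hasSum (ρ * z)

variable (v) in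
/-- The dilation `F ↦ F(ρ ·)` as an operator from `H_v^∞` to `H_v^0`. -/
def dilate (ρ : 𝔻) : GrowthSpace v →L[ℂ] LittleGrowthSpace v :=
  LinearMap.mkContinuous
    { toFun := fun F => LittleGrowthSpace.ofBounded v (fun z => F (ρ * z))
        (holomorphic_of_hasSum (F.hasSum_dilate ρ)) ((v ρ)⁻¹ * ‖F‖) fun z =>
          (F.norm_apply_le _).trans (mul_le_mul_of_nonneg_right
            (inv_anti₀ (v.pos _) (v.decreasing _ _ (norm_coe_mul_le_left ρ z))) (norm_nonneg _))
      map_add' := fun _ _ => rfl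
      map_smul' := fun _ _ => rfl }
    1 fun F => by
      rw [one_mul]
      -- Contractivity: v(z) ≤ v(ρz) because |ρz| ≤ |z|.
      exact LittleGrowthSpace.norm_le fun z =>
        (mul_le_mul_of_nonneg_right (v.decreasing _ _ (norm_coe_mul_le_right ρ z))
          (norm_nonneg _)).trans (F.le_norm (ρ * z))

lemma dilate_apply (ρ : 𝔻) (F : GrowthSpace v) (z : 𝔻) : dilate v ρ F z = F (ρ * z) := rfl

lemma norm_dilate_apply_le (ρ : 𝔻) (F : GrowthSpace v) : ‖dilate v ρ F‖ ≤ ‖F‖ := by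
  simpa using (dilate v ρ).le_of_opNorm_le (LinearMap.mkContinuous_norm_le _ zero_le_one _) F

lemma hasSum_dilate (ρ : 𝔻) (F : GrowthSpace v) :
    HasSum (fun n => (taylorCoeff F n * (ρ : ℂ) ^ n) • LittleGrowthSpace.monomial v n)
      (dilate v ρ F) :=
  LittleGrowthSpace.hasSum_monomial (F.hasSum ρ).summable.norm (F.hasSum_dilate ρ)

end Dilation

/-! ### Functionals are small on functions concentrated near the boundary -/

section GlidingHump

variable {v : Weight}

/-- Each new hump is tiny where the current g is not yet small, so adding it raises φ by ε while the
weighted supremum stays below 2. -/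
lemma exists_norm_lt_two_of_hump {φ : StrongDual ℂ (LittleGrowthSpace v)} {ε : ℝ}
    (H : ∀ R : 𝔻, ∀ δ > 0, ∃ f : LittleGrowthSpace v, ‖f‖ ≤ 1 ∧
      (∀ z : 𝔻, ‖(z : ℂ)‖ ≤ ‖(R : ℂ)‖ → v z * ‖f z‖ ≤ δ) ∧ ε < ‖φ f‖) (N : ℕ) :
    ∃ g : LittleGrowthSpace v, ‖g‖ < 2 ∧ N * ε ≤ (φ g).re := by
  induction N with
  | zero => exact ⟨0, by simp⟩
  | succ N ih =>
    obtain ⟨g, hg, hN⟩ := ih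
    -- The first bound gives 1 + 1/2 outside the disc of radius |R|; the second uses half of the gap
    -- left below 2 inside it.
    set η : ℝ := min (1 / 2) ((2 - ‖g‖) / 2) with hη
    have hη0 : 0 < η := lt_min (by norm_num) (by linarith)
    have hη1 : η ≤ 1 / 2 := min_le_left _ _
    have hη2 : η ≤ (2 - ‖g‖) / 2 := min_le_right _ _
    obtain ⟨R, hR⟩ := g.exists_lt hη0
    obtain ⟨f, hf1, hfR, hfε⟩ := H R η hη0
    obtain ⟨c, hc, hcφ⟩ := Complex.exists_norm_mul_eq_self (φ f)
    have hc0 : c ≠ 0 := by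
      rintro rfl
      simp at hc
    refine ⟨g + c⁻¹ • f, ?_, ?_⟩
    · have : ‖g + c⁻¹ • f‖ ≤ max (3 / 2) ((2 + ‖g‖) / 2) := by
        refine LittleGrowthSpace.norm_le fun z => ?_
        have h1 : v z * ‖(g + c⁻¹ • f) z‖ ≤ v z * ‖g z‖ + v z * ‖f z‖ := by
          rw [← mul_add]
          refine mul_le_mul_of_nonneg_left ?_ (v.pos z).le
          rw [LittleGrowthSpace.add_apply, LittleGrowthSpace.smul_apply]
          refine (norm_add_le _ _).trans ?_
          rw [norm_mul, norm_inv, hc, inv_one, one_mul]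
        by_cases hz : ‖(z : ℂ)‖ ≤ ‖(R : ℂ)‖
        · refine le_max_of_le_right ?_
          have h2 := hfR z hz
          have h3 := g.le_norm z
          linarith
        · refine le_max_of_le_left ?_
          have h2 := hR z (not_le.1 hz)
          have h3 := f.le_norm z
          linarith
      exact this.trans_lt (max_lt (by norm_num) (by linarith))
    · have e : c⁻¹ * φ f = (‖φ f‖ : ℂ) := by
        rw [inv_mul_eq_iff_eq_mul₀ hc0, hcφ]
      rw [map_add, map_smul, smul_eq_mul, e, Complex.add_re, Complex.ofReal_re]
      push_cast
      linarith

lemma exists_forall_norm_apply_le (φ : StrongDual ℂ (LittleGrowthSpace v)) {ε : ℝ} (hε : 0 < ε) :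
    ∃ R : 𝔻, ∃ δ > 0, ∀ f : LittleGrowthSpace v, ‖f‖ ≤ 1 →
      (∀ z : 𝔻, ‖(z : ℂ)‖ ≤ ‖(R : ℂ)‖ → v z * ‖f z‖ ≤ δ) → ‖φ f‖ ≤ ε := by
  by_contra! H
  obtain ⟨N, hN⟩ := exists_nat_gt (2 * ‖φ‖ / ε)
  obtain ⟨g, hg, hgN⟩ := exists_norm_lt_two_of_hump H N
  rw [div_lt_iff₀ hε] at hN
  have h1 := (Complex.re_le_norm (φ g)).trans (φ.le_opNorm g)
  have h2 := mul_le_mul_of_nonneg_left hg.le (norm_nonneg φ)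
  linarith

/-- A functional on `H_v^0` is controlled by a small multiple of the norm and by the supremum on a
compact disc. -/
lemma exists_norm_apply_le_add (φ : StrongDual ℂ (LittleGrowthSpace v)) {ε : ℝ} (hε : 0 < ε) :
    ∃ R : 𝔻, ∃ C > 0, ∀ (f : LittleGrowthSpace v) (m : ℝ),
      (∀ z : 𝔻, ‖(z : ℂ)‖ ≤ ‖(R : ℂ)‖ → ‖f z‖ ≤ m) → ‖φ f‖ ≤ ε * ‖f‖ + C * m := by
  obtain ⟨R, δ, hδ, H⟩ := exists_forall_norm_apply_le φ hε
  have hv := v.pos 0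
  refine ⟨R, ε * (v 0 / δ), by positivity, fun f m hm => ?_⟩
  have hm0 : 0 ≤ m := (norm_nonneg _).trans (hm R le_rfl)
  rcases eq_or_ne f 0 with rfl | hf
  · rw [map_zero, norm_zero, norm_zero]
    positivity
  have hf0 : 0 < ‖f‖ := norm_pos_iff.2 hf
  -- Dividing f by t achieves both norm at most 1 and size at most δ on the disc; positivity of t
  -- needs f ≠ 0.
  set t : ℝ := ‖f‖ + v 0 / δ * m with ht
  have ht0 : 0 < t := by positivity
  have htn : ‖((t⁻¹ : ℝ) : ℂ)‖ = t⁻¹ := by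
    rw [Complex.norm_real, Real.norm_of_nonneg (inv_nonneg.2 ht0.le)]
  have := H (((t⁻¹ : ℝ) : ℂ) • f) (by
    rw [norm_smul, htn, inv_mul_le_iff₀ ht0, mul_one]
    exact le_add_of_nonneg_right (by positivity)) (fun z hz => by
    rw [LittleGrowthSpace.smul_apply, norm_mul, htn, mul_left_comm, inv_mul_le_iff₀ ht0]
    have h1 := mul_le_mul (v.le_apply_zero z) (hm z hz) (norm_nonneg _) hv.le
    have h2 : t * δ = ‖f‖ * δ + v 0 * m := by
      rw [ht]
      field_simp
    have h3 : 0 ≤ ‖f‖ * δ := by positivity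
    linarith)
  rw [map_smul, norm_smul, htn, inv_mul_le_iff₀ ht0] at this
  calc ‖φ f‖ ≤ t * ε := this
    _ = ε * ‖f‖ + ε * (v 0 / δ) * m := by rw [ht]; ring

end GlidingHump

/-! ### Convergence of dilations -/

section Convergence

variable {v : Weight}

/-- The filter of points of the disc that tend to `1`. -/
def toOne : Filter 𝔻 := comap (fun z : 𝔻 => (z : ℂ)) (𝓝 1)

instance : NeBot toOne :=
  mem_closure_iff_comap_neBot.1 (by
    rw [closure_ball _ one_ne_zero]
    simp : (1 : ℂ) ∈ closure (Metric.ball (0 : ℂ) 1))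

lemma tendsto_coe_toOne : Tendsto (fun z : 𝔻 => (z : ℂ)) toOne (𝓝 1) := tendsto_comap

/-- Dilations converge to the identity uniformly on compact discs and on bounded sets. -/
lemma exists_tendsto_norm_dilate_sub_le (v : Weight) (R : 𝔻) :
    ∃ c : 𝔻 → ℝ, Tendsto c toOne (𝓝 0) ∧ ∀ (ρ : 𝔻) (F : GrowthSpace v) (z : 𝔻),
      ‖(z : ℂ)‖ ≤ ‖(R : ℂ)‖ → ‖dilate v ρ F z - F z‖ ≤ c ρ * ‖F‖ := by
  have hs := GrowthSpace.summable_norm_coeff (v := v) R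
  have hb : ∀ (ρ : 𝔻) (n : ℕ), ‖(ρ : ℂ) ^ n - 1‖ ≤ 2 := fun ρ n => by
    refine (norm_sub_le _ _).trans ?_
    rw [norm_pow, norm_one]
    linarith [pow_le_one₀ (n := n) (norm_nonneg (ρ : ℂ)) ρ.norm_lt_one.le]
  -- This majorant does not involve F; it tends to 0 by dominated convergence.
  refine ⟨fun ρ => ∑' n, ‖GrowthSpace.coeff v n‖ * ‖(R : ℂ)‖ ^ n * ‖(ρ : ℂ) ^ n - 1‖, ?_, ?_⟩
  · have := tendsto_tsum_of_dominated_convergence (𝓕 := toOne)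
      (f := fun (ρ : 𝔻) n => ‖GrowthSpace.coeff v n‖ * ‖(R : ℂ)‖ ^ n * ‖(ρ : ℂ) ^ n - 1‖)
      (g := fun _ => 0) (hs.mul_right 2) (fun n => by
        have h := ((tendsto_coe_toOne.pow n).sub_const 1).norm.const_mul
          (‖GrowthSpace.coeff v n‖ * ‖(R : ℂ)‖ ^ n)
        simpa using h) (.of_forall fun ρ n => by
        rw [Real.norm_of_nonneg (by positivity)]
        exact mul_le_mul_of_nonneg_left (hb ρ n) (by positivity))
    simpa using this
  · intro ρ F z hz
    have hs' : Summable fun n =>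
        ‖GrowthSpace.coeff v n‖ * ‖(R : ℂ)‖ ^ n * ‖(ρ : ℂ) ^ n - 1‖ :=
      Summable.of_nonneg_of_le (fun n => by positivity)
        (fun n => mul_le_mul_of_nonneg_left (hb ρ n) (by positivity)) (hs.mul_right 2)
    have h := (F.hasSum_dilate ρ z).sub (F.hasSum z)
    rw [dilate_apply, ← h.tsum_eq]
    refine tsum_of_norm_bounded (hs'.hasSum.mul_right ‖F‖) fun n => ?_
    have e : taylorCoeff F n * (ρ : ℂ) ^ n * (z : ℂ) ^ n - taylorCoeff F n * (z : ℂ) ^ n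
        = GrowthSpace.coeff v n F * (z : ℂ) ^ n * ((ρ : ℂ) ^ n - 1) := by
      rw [GrowthSpace.coeff_apply]
      ring
    rw [e, norm_mul, norm_mul, norm_pow]
    calc _ ≤ ‖GrowthSpace.coeff v n‖ * ‖F‖ * ‖(R : ℂ)‖ ^ n * ‖(ρ : ℂ) ^ n - 1‖ := by
          gcongr
          exact (GrowthSpace.coeff v n).le_opNorm F
      _ = _ := by ring

/-- On a compact disc convergence is uniform. Near the boundary, z and ρz both lie where the
weighted values of f are small. -/
lemma tendsto_dilate (f : LittleGrowthSpace v) :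
    Tendsto (fun ρ => dilate v ρ f.toGrowth) toOne (𝓝 f) := by
  rw [Metric.tendsto_nhds]
  intro ε hε
  obtain ⟨R, hR⟩ := f.exists_lt (by positivity : 0 < ε / 4)
  obtain ⟨S, hS⟩ := exists_norm_lt R
  obtain ⟨c, hc, H⟩ := exists_tendsto_norm_dilate_sub_le v S
  have h1 : ∀ᶠ ρ in toOne, v 0 * (c ρ * ‖f‖) < ε / 2 := by
    have h := (hc.mul_const ‖f‖).const_mul (v 0)
    rw [zero_mul, mul_zero] at h
    exact h.eventually (gt_mem_nhds (by positivity))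
  have h2 : ∀ᶠ ρ : 𝔻 in toOne, ‖(R : ℂ)‖ < ‖(ρ : ℂ)‖ * ‖(S : ℂ)‖ := by
    have h := tendsto_coe_toOne.norm.mul_const ‖(S : ℂ)‖
    rw [norm_one, one_mul] at h
    exact h.eventually (lt_mem_nhds hS)
  filter_upwards [h1, h2] with ρ hρ1 hρ2
  rw [dist_eq_norm]
  refine lt_of_le_of_lt (LittleGrowthSpace.norm_le fun z => ?_) (half_lt_self hε)
  rw [LittleGrowthSpace.sub_apply]
  by_cases hz : ‖(z : ℂ)‖ ≤ ‖(S : ℂ)‖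
  · exact (mul_le_mul (v.le_apply_zero z) (H ρ f.toGrowth z hz) (norm_nonneg _)
      (v.pos 0).le).trans hρ1.le
  · rw [not_le] at hz
    have h3 := hR z (hS.trans hz)
    have h4 := hR (ρ * z) (hρ2.trans_le (by
      rw [UnitDisc.coe_mul, norm_mul]
      exact mul_le_mul_of_nonneg_left hz.le (norm_nonneg _)))
    have h5 := mul_le_mul_of_nonneg_right (v.decreasing _ _ (norm_coe_mul_le_right ρ z))
      (norm_nonneg (f (ρ * z)))
    have h6 := mul_le_mul_of_nonneg_left (norm_sub_le (f (ρ * z)) (f z)) (v.pos z).le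
    rw [dilate_apply]
    linarith

/-- A functional on `H_v^0` is uniformly Cauchy along dilations of bounded subsets of `H_v^∞`. -/
lemma eventually_norm_apply_dilate_sub_le (φ : StrongDual ℂ (LittleGrowthSpace v)) {ε : ℝ}
    (hε : 0 < ε) : ∀ᶠ p in toOne ×ˢ toOne, ∀ F : GrowthSpace v,
      ‖φ (dilate v p.1 F) - φ (dilate v p.2 F)‖ ≤ ε * ‖F‖ := by
  obtain ⟨R, C, hC, H⟩ := exists_norm_apply_le_add φ (by positivity : 0 < ε / 4)
  obtain ⟨c, hc, Hc⟩ := exists_tendsto_norm_dilate_sub_le v R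
  have h1 : ∀ᶠ p in toOne ×ˢ toOne, C * (c p.1 + c p.2) < ε / 2 := by
    have h := ((hc.comp (tendsto_fst (g := toOne))).add
      (hc.comp (tendsto_snd (f := toOne)))).const_mul C
    rw [add_zero, mul_zero] at h
    exact h.eventually (gt_mem_nhds (by positivity))
  filter_upwards [h1] with p hp F
  have h2 := H (dilate v p.1 F - dilate v p.2 F) ((c p.1 + c p.2) * ‖F‖) fun z hz => by
    rw [LittleGrowthSpace.sub_apply, ← sub_sub_sub_cancel_right _ _ (F z), add_mul]
    exact (norm_sub_le _ _).trans (add_le_add (Hc p.1 F z hz) (Hc p.2 F z hz))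
  have h3 : ‖dilate v p.1 F - dilate v p.2 F‖ ≤ 2 * ‖F‖ := by
    refine (norm_sub_le _ _).trans ?_
    linarith [norm_dilate_apply_le p.1 F, norm_dilate_apply_le p.2 F]
  have h4 := mul_le_mul_of_nonneg_right hp.le (norm_nonneg F)
  have h5 := mul_le_mul_of_nonneg_left h3 (by positivity : 0 ≤ ε / 4)
  rw [map_sub] at h2
  linarith

lemma exists_tendsto_apply_dilate (φ : StrongDual ℂ (LittleGrowthSpace v)) (F : GrowthSpace v) :
    ∃ y, Tendsto (fun ρ => φ (dilate v ρ F)) toOne (𝓝 y) := by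
  refine cauchy_map_iff_exists_tendsto.1 (cauchy_map_iff.2 ⟨inferInstance, ?_⟩)
  rw [Metric.uniformity_basis_dist.tendsto_right_iff]
  intro ε hε
  filter_upwards [eventually_norm_apply_dilate_sub_le φ
    (by positivity : 0 < ε / (‖F‖ + 1))] with p hp
  rw [dist_eq_norm]
  refine (hp F).trans_lt ?_
  rw [div_mul_eq_mul_div, div_lt_iff₀ (by positivity)]
  exact mul_lt_mul_of_pos_left (lt_add_one _) hε

/-- Composition with dilations approximates every functional on `H_v^0` in norm. -/
lemma tendsto_comp_dilate (φ : StrongDual ℂ (LittleGrowthSpace v)) :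
    Tendsto (fun ρ => (φ.comp (dilate v ρ)).comp
      (LittleGrowthSpace.inclusion v).toContinuousLinearMap) toOne (𝓝 φ) := by
  rw [Metric.tendsto_nhds]
  intro ε hε
  -- With ρ fixed, the second dilation parameter is sent to 1 in the uniform Cauchy estimate.
  filter_upwards [(eventually_norm_apply_dilate_sub_le φ (half_pos hε)).curry] with ρ hρ
  rw [dist_eq_norm]
  refine lt_of_le_of_lt (ContinuousLinearMap.opNorm_le_bound _ (half_pos hε).le fun f => ?_)
    (half_lt_self hε)
  have h1 : Tendsto (fun σ => ‖φ (dilate v ρ f.toGrowth) - φ (dilate v σ f.toGrowth)‖) toOne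
      (𝓝 ‖φ (dilate v ρ f.toGrowth) - φ f‖) :=
    ((φ.continuous.tendsto f).comp (tendsto_dilate f)).const_sub _ |>.norm
  exact le_of_tendsto h1 (hρ.mono fun σ hσ => hσ f.toGrowth)

end Convergence

/-! ### The bidual of `H_v^0` -/

section Bidual

variable {v : Weight}

lemma norm_pointEval_le (v : Weight) (z : 𝔻) : ‖pointEval v z‖ ≤ (v z)⁻¹ :=
  LinearMap.mkContinuous_norm_le _ (inv_nonneg.2 (v.pos z).le) _

lemma hasSum_apply_pointEval (Φ : StrongDual ℂ (StrongDual ℂ (LittleGrowthSpace v))) (z : 𝔻) :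
    HasSum (fun n => Φ (LittleGrowthSpace.coeff v n) * (z : ℂ) ^ n) (Φ (pointEval v z)) := by
  simpa [mul_comm] using (LittleGrowthSpace.hasSum_pointEval (v := v) z).mapL Φ

lemma mul_norm_apply_pointEval_le (Φ : StrongDual ℂ (StrongDual ℂ (LittleGrowthSpace v)))
    (z : 𝔻) : v z * ‖Φ (pointEval v z)‖ ≤ ‖Φ‖ := by
  have h := (Φ.le_opNorm _).trans
    (mul_le_mul_of_nonneg_left (norm_pointEval_le v z) (norm_nonneg Φ))
  rwa [← div_eq_mul_inv, le_div_iff₀ (v.pos z), mul_comm] at h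

variable (v) in
/-- The map `Φ ↦ (z ↦ Φ(δ_z))` from the bidual of `H_v^0` to `H_v^∞`. -/
def canonicalMap : StrongDual ℂ (StrongDual ℂ (LittleGrowthSpace v)) →ₗ[ℂ] GrowthSpace v where
  toFun Φ := ⟨fun z => Φ (pointEval v z), holomorphic_of_hasSum (hasSum_apply_pointEval Φ), ‖Φ‖, by
    rintro _ ⟨z, rfl⟩
    exact mul_norm_apply_pointEval_le Φ z⟩
  map_add' _ _ := rfl
  map_smul' _ _ := rfl

lemma taylorCoeff_canonicalMap (Φ : StrongDual ℂ (StrongDual ℂ (LittleGrowthSpace v))) (n : ℕ) :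
    taylorCoeff (canonicalMap v Φ) n = Φ (LittleGrowthSpace.coeff v n) :=
  taylorCoeff_eq_of_hasSum (hasSum_apply_pointEval Φ) n

/-- The numbers φ(z^n) are bounded by ‖φ‖ v(0), so the factors ρ^n give convergence in the dual
norm. -/
lemma hasSum_comp_dilate (φ : StrongDual ℂ (LittleGrowthSpace v)) (ρ : 𝔻) :
    HasSum (fun n => ((ρ : ℂ) ^ n * φ (LittleGrowthSpace.monomial v n)) •
        LittleGrowthSpace.coeff v n)
      ((φ.comp (dilate v ρ)).comp (LittleGrowthSpace.inclusion v).toContinuousLinearMap) := by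
  have hs : Summable fun n => ((ρ : ℂ) ^ n * φ (LittleGrowthSpace.monomial v n)) •
      LittleGrowthSpace.coeff v n := by
    refine Summable.of_norm_bounded
      ((LittleGrowthSpace.summable_norm_coeff (v := v) ρ).mul_right (‖φ‖ * v 0)) fun n => ?_
    rw [norm_smul, norm_mul, norm_pow]
    calc _ ≤ ‖(ρ : ℂ)‖ ^ n * (‖φ‖ * v 0) * ‖LittleGrowthSpace.coeff v n‖ := by
          gcongr
          exact (φ.le_opNorm _).trans (mul_le_mul_of_nonneg_left
            (LittleGrowthSpace.norm_monomial_le n) (norm_nonneg φ))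
      _ = _ := by ring
  convert hs.hasSum
  ext f
  refine HasSum.unique ?_ (hs.hasSum.mapL (ContinuousLinearMap.apply ℂ ℂ f))
  refine HasSum.congr_fun ((hasSum_dilate ρ f.toGrowth).mapL φ) fun n => ?_
  simp only [ContinuousLinearMap.apply_apply, map_smul, smul_eq_mul,
    LittleGrowthSpace.coeff_apply]
  ring

/-- An element of the bidual is recovered from its image in `H_v^∞`. -/
lemma tendsto_apply_dilate_canonicalMap
    (Φ : StrongDual ℂ (StrongDual ℂ (LittleGrowthSpace v)))
    (φ : StrongDual ℂ (LittleGrowthSpace v)) :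
    Tendsto (fun ρ => φ (dilate v ρ (canonicalMap v Φ))) toOne (𝓝 (Φ φ)) := by
  refine ((Φ.continuous.tendsto φ).comp (tendsto_comp_dilate φ)).congr fun ρ => ?_
  refine ((hasSum_comp_dilate φ ρ).mapL Φ).unique ?_
  refine HasSum.congr_fun ((hasSum_dilate ρ (canonicalMap v Φ)).mapL φ) fun n => ?_
  simp only [map_smul, smul_eq_mul, taylorCoeff_canonicalMap]
  ring

lemma norm_canonicalMap (Φ : StrongDual ℂ (StrongDual ℂ (LittleGrowthSpace v))) :
    ‖canonicalMap v Φ‖ = ‖Φ‖ := by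
  refine le_antisymm (GrowthSpace.norm_le (mul_norm_apply_pointEval_le Φ))
    (Φ.opNorm_le_bound (norm_nonneg _) fun φ => ?_)
  refine le_of_tendsto (tendsto_apply_dilate_canonicalMap Φ φ).norm (.of_forall fun ρ => ?_)
  rw [mul_comm]
  exact (φ.le_opNorm _).trans
    (mul_le_mul_of_nonneg_left (norm_dilate_apply_le ρ _) (norm_nonneg φ))

lemma canonicalMap_surjective : Function.Surjective (canonicalMap v) := by
  intro F
  -- The preimage of F is φ ↦ lim φ(D_ρ F).
  choose y hy using fun φ : StrongDual ℂ (LittleGrowthSpace v) => exists_tendsto_apply_dilate φ F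
  refine ⟨LinearMap.mkContinuous
    { toFun := y
      map_add' := fun φ ψ => tendsto_nhds_unique (hy (φ + ψ)) ((hy φ).add (hy ψ))
      map_smul' := fun c φ => tendsto_nhds_unique (hy (c • φ)) ((hy φ).const_mul c) }
    ‖F‖ fun φ => le_of_tendsto (hy φ).norm (.of_forall fun ρ => ?_), ?_⟩
  · rw [mul_comm]
    exact (φ.le_opNorm _).trans
      (mul_le_mul_of_nonneg_left (norm_dilate_apply_le ρ F) (norm_nonneg φ))
  · refine GrowthSpace.ext' fun z => tendsto_nhds_unique (hy (pointEval v z)) ?_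
    obtain ⟨c, hc, H⟩ := exists_tendsto_norm_dilate_sub_le v z
    refine tendsto_iff_norm_sub_tendsto_zero.2 (squeeze_zero (fun _ => norm_nonneg _)
      (fun ρ => H ρ F z le_rfl) ?_)
    simpa using hc.mul_const ‖F‖

variable (v) in
/-- The canonical isometric isomorphism from the bidual of `H_v^0` onto `H_v^∞`. -/
def canonicalIso : StrongDual ℂ (StrongDual ℂ (LittleGrowthSpace v)) ≃ₗᵢ[ℂ] GrowthSpace v :=
  LinearIsometryEquiv.ofSurjective (F := StrongDual ℂ (StrongDual ℂ (LittleGrowthSpace v)))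
    ⟨canonicalMap v, norm_canonicalMap⟩ canonicalMap_surjective

lemma canonicalIso_apply (Φ : StrongDual ℂ (StrongDual ℂ (LittleGrowthSpace v))) :
    canonicalIso v Φ = canonicalMap v Φ := rfl

end Bidual

/-! ### The Cesàro-type operator -/

section Cesaro

lemma exists_apply_eq_cesaro_one {μ : Measure (Set.Ico (0 : ℝ) 1)} {v w : Weight}
    {S : LittleGrowthSpace v →L[ℂ] LittleGrowthSpace w}
    (hS : IsCesaroLittle μ S) :
    ∃ g : LittleGrowthSpace w, ∀ z, g z = cesaro μ (fun _ => 1) z := by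
  refine ⟨S (LittleGrowthSpace.monomial v 0), fun z => ?_⟩
  rw [hS]
  congr 1

variable (μ : Measure (Set.Ico (0 : ℝ) 1)) [IsFiniteMeasure μ] {v w : Weight}

lemma norm_moment_le (n : ℕ) : ‖(moment μ n : ℂ)‖ ≤ μ.real Set.univ := by
  have := norm_integral_le_of_norm_le_const (μ := μ) (f := fun t => (t : ℝ) ^ n) (C := 1)
    (ae_of_all _ fun t => by
      rw [norm_pow, Real.norm_of_nonneg t.2.1]
      exact pow_le_one₀ t.2.1 t.2.2.le)
  simpa [moment] using this

lemma hasSum_cesaro {f : 𝔻 → ℂ} (hf : Holomorphic f) (z : 𝔻) :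
    HasSum (fun n => (moment μ n : ℂ) * (∑ k ∈ Finset.range (n + 1), taylorCoeff f k) *
      (z : ℂ) ^ n) (cesaro μ f z) :=
  (summable_cesaro μ hf z).of_norm.hasSum

/-- The moments are bounded, and the rest is dominated by the Cauchy product of ∑ ‖coeff_n‖ |z|^n
with a geometric series. -/
lemma summable_moment_smul_coeff (v : Weight) (z : 𝔻) :
    Summable fun n => ((moment μ n : ℂ) * (z : ℂ) ^ n) •
      ∑ k ∈ Finset.range (n + 1), LittleGrowthSpace.coeff v k := by
  have h1 : Summable fun n => ‖‖LittleGrowthSpace.coeff v n‖ * ‖(z : ℂ)‖ ^ n‖ :=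
    (LittleGrowthSpace.summable_norm_coeff z).norm
  have h2 : Summable fun n : ℕ => ‖‖(z : ℂ)‖ ^ n‖ := by
    simpa using summable_geometric_of_lt_one (norm_nonneg _) z.norm_lt_one
  have h3 := (summable_norm_sum_mul_range_of_summable_norm h1 h2).mul_left (μ.real Set.univ)
  refine Summable.of_norm_bounded h3 fun n => ?_
  have e : ∑ k ∈ Finset.range (n + 1), ‖LittleGrowthSpace.coeff v k‖ * ‖(z : ℂ)‖ ^ k *
        ‖(z : ℂ)‖ ^ (n - k)
      = ‖(z : ℂ)‖ ^ n * ∑ k ∈ Finset.range (n + 1), ‖LittleGrowthSpace.coeff v k‖ := by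
    rw [Finset.mul_sum]
    refine Finset.sum_congr rfl fun k hk => ?_
    rw [mul_assoc, ← pow_add, Nat.add_sub_cancel' (by simpa [Nat.lt_succ_iff] using hk), mul_comm]
  rw [e, norm_smul, norm_mul, norm_pow, mul_assoc, Real.norm_of_nonneg (by positivity)]
  gcongr
  · exact norm_moment_le μ n
  · exact norm_sum_le _ _

lemma hasSum_pointEval_comp {S : LittleGrowthSpace v →L[ℂ] LittleGrowthSpace w}
    (hS : IsCesaroLittle μ S) (z : 𝔻) :
    HasSum (fun n => ((moment μ n : ℂ) * (z : ℂ) ^ n) •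
      ∑ k ∈ Finset.range (n + 1), LittleGrowthSpace.coeff v k) ((pointEval w z).comp S) := by
  have hs := summable_moment_smul_coeff μ v z
  convert hs.hasSum
  ext f
  refine HasSum.unique ?_ (hs.hasSum.mapL (ContinuousLinearMap.apply ℂ ℂ f))
  rw [ContinuousLinearMap.comp_apply, LittleGrowthSpace.pointEval_apply, hS f z]
  refine HasSum.congr_fun (hasSum_cesaro μ f.toGrowth.2.1 z) fun n => ?_
  simp only [ContinuousLinearMap.apply_apply, _root_.smul_apply, _root_.sum_apply,
    smul_eq_mul, LittleGrowthSpace.coeff_apply]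
  ring

/-- The bitranspose of the operator on `H_v^0` is the Cesàro-type operator on `H_v^∞`. -/
lemma canonicalMap_bitranspose {S : LittleGrowthSpace v →L[ℂ] LittleGrowthSpace w}
    (hS : IsCesaroLittle μ S) (Φ : StrongDual ℂ (StrongDual ℂ (LittleGrowthSpace v))) (z : 𝔻) :
    canonicalMap w (bitranspose S Φ) z = cesaro μ (canonicalMap v Φ) z := by
  refine HasSum.unique ((hasSum_pointEval_comp μ hS z).mapL Φ) ?_
  refine HasSum.congr_fun (hasSum_cesaro μ (canonicalMap v Φ).2.1 z) fun n => ?_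
  simp only [map_smul, map_sum, smul_eq_mul, taylorCoeff_canonicalMap]
  ring

lemma norm_bitranspose_apply_le {E F : Type*} [NormedAddCommGroup E] [NormedSpace ℂ E]
    [NormedAddCommGroup F] [NormedSpace ℂ F] (S : E →L[ℂ] F)
    (Φ : StrongDual ℂ (StrongDual ℂ E)) : ‖bitranspose S Φ‖ ≤ ‖S‖ * ‖Φ‖ := by
  refine ContinuousLinearMap.opNorm_le_bound _ (by positivity) fun φ => ?_
  calc ‖Φ (φ.comp S)‖ ≤ ‖Φ‖ * (‖φ‖ * ‖S‖) :=
        (Φ.le_opNorm _).trans (mul_le_mul_of_nonneg_left (φ.opNorm_comp_le S) (norm_nonneg _))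
    _ = ‖S‖ * ‖Φ‖ * ‖φ‖ := by ring

variable {μ}

lemma canonicalIso_bitranspose {T : GrowthSpace v →L[ℂ] GrowthSpace w}
    {S : LittleGrowthSpace v →L[ℂ] LittleGrowthSpace w} (hT : IsCesaroBig μ T)
    (hS : IsCesaroLittle μ S) (Φ : StrongDual ℂ (StrongDual ℂ (LittleGrowthSpace v))) :
    canonicalIso w (bitranspose S Φ) = T (canonicalIso v Φ) :=
  GrowthSpace.ext' fun z => by
    rw [hT, canonicalIso_apply, canonicalIso_apply, canonicalMap_bitranspose μ hS]

/-- T is isometrically conjugate to the bitranspose of S, and T restricts to S on the isometrically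
embedded H_v^0. -/
lemma norm_big_eq_norm_little {T : GrowthSpace v →L[ℂ] GrowthSpace w}
    {S : LittleGrowthSpace v →L[ℂ] LittleGrowthSpace w} (hT : IsCesaroBig μ T)
    (hS : IsCesaroLittle μ S) : ‖T‖ = ‖S‖ := by
  refine le_antisymm (T.opNorm_le_bound (norm_nonneg _) fun F => ?_)
    (S.opNorm_le_bound (norm_nonneg _) fun f => ?_)
  · obtain ⟨Φ, rfl⟩ := (canonicalIso v).surjective F
    rw [← canonicalIso_bitranspose hT hS, LinearIsometryEquiv.norm_map,
      LinearIsometryEquiv.norm_map]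
    exact norm_bitranspose_apply_le S Φ
  · have e : (S f).toGrowth = T f.toGrowth := GrowthSpace.ext' fun z => by
      rw [hT]
      exact hS f z
    exact (congrArg norm e).trans_le (T.le_opNorm f.toGrowth)

lemma exists_big_of_little {S : LittleGrowthSpace v →L[ℂ] LittleGrowthSpace w}
    (hS : IsCesaroLittle μ S) : ∃ T : GrowthSpace v →L[ℂ] GrowthSpace w, IsCesaroBig μ T := by
  refine ⟨((canonicalIso w).toContinuousLinearEquiv : _ →L[ℂ] _).comp ((bitranspose S).comp
    ((canonicalIso v).symm.toContinuousLinearEquiv : _ →L[ℂ] _)), fun F z => ?_⟩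
  obtain ⟨Φ, rfl⟩ := (canonicalIso v).surjective F
  change canonicalIso w (bitranspose S ((canonicalIso v).symm (canonicalIso v Φ))) z = _
  rw [LinearIsometryEquiv.symm_apply_apply]
  exact canonicalMap_bitranspose μ hS Φ z

/-! ### From H_v^∞ to H_v^0: monomials and density -/

lemma cesaro_monomial_add (k : ℕ) (z : 𝔻) :
    cesaro μ (LittleGrowthSpace.monomial v k) z +
      ∑ n ∈ Finset.range k, (moment μ n : ℂ) * (z : ℂ) ^ n = cesaro μ (fun _ => 1) z := by
  have h1 := hasSum_cesaro μ (LittleGrowthSpace.monomial v k).toGrowth.2.1 z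
  have e0 : (fun _ => 1 : 𝔻 → ℂ) = LittleGrowthSpace.monomial v 0 := by
    funext ζ
    rw [LittleGrowthSpace.monomial_apply, pow_zero]
  have h0 := hasSum_cesaro μ (LittleGrowthSpace.monomial v 0).toGrowth.2.1 z
  have h2 : HasSum (fun n => if n ∈ Finset.range k then (moment μ n : ℂ) * (z : ℂ) ^ n else 0)
      (∑ n ∈ Finset.range k, (moment μ n : ℂ) * (z : ℂ) ^ n) := by
    rw [← Finset.sum_congr rfl fun n hn => if_pos hn]
    exact hasSum_sum_of_ne_finset_zero fun n hn => if_neg hn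
  rw [e0]
  refine (h1.add h2).unique ?_
  convert h0 using 2 with n
  simp only [LittleGrowthSpace.taylorCoeff_monomial, Finset.sum_pi_single', Finset.mem_range]
  -- The coefficient sums of z^k are 0 for n < k and 1 for n ≥ k; those of the constant 1 are always
  -- 1.
  rcases lt_or_ge n k with h | h
  · simp [h, not_lt.2 (Nat.succ_le_of_lt h)]
  · simp [not_lt.2 h, Nat.lt_succ_of_le h]

lemma isClosed_littleSubmodule : IsClosed (littleSubmodule v : Set (GrowthSpace v)) := by
  refine isClosed_of_closure_subset fun F hF => ?_
  change VanishesAtBoundary v F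
  rw [VanishesAtBoundary, Metric.tendsto_nhds]
  intro ε hε
  obtain ⟨g, hg, hFg⟩ := Metric.mem_closure_iff.1 hF (ε / 2) (half_pos hε)
  have hg' : VanishesAtBoundary v g := hg
  filter_upwards [hg'.eventually (gt_mem_nhds (half_pos hε))] with z hz
  rw [dist_eq_norm] at hFg ⊢
  have h1 := (F - g).le_norm z
  rw [GrowthSpace.sub_apply] at h1
  have h2 := mul_le_mul_of_nonneg_left (norm_le_norm_sub_add (F z) (g z)) (v.pos z).le
  rw [sub_zero, Real.norm_of_nonneg (mul_nonneg (v.pos z).le (norm_nonneg _))]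
  linarith

/-- Each f is a norm limit of its dilations, and each dilation is a norm-convergent series of
monomials. -/
lemma closure_span_monomial :
    (Submodule.span ℂ (Set.range (LittleGrowthSpace.monomial v))).topologicalClosure = ⊤ := by
  refine Submodule.eq_top_iff'.2 fun f => ?_
  refine mem_closure_of_tendsto (tendsto_dilate f) (.of_forall fun ρ => ?_) |>
    closure_minimal (subset_refl _) (Submodule.isClosed_topologicalClosure _)
  refine mem_closure_of_tendsto (hasSum_dilate ρ f.toGrowth) (.of_forall fun s => ?_)
  exact Submodule.sum_mem _ fun n _ =>
    Submodule.smul_mem _ _ (Submodule.subset_span (Set.mem_range_self n))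

lemma map_monomial_mem {T : GrowthSpace v →L[ℂ] GrowthSpace w} (hT : IsCesaroBig μ T)
    {g : LittleGrowthSpace w} (hg : ∀ z, g z = cesaro μ (fun _ => 1) z) (k : ℕ) :
    T (LittleGrowthSpace.monomial v k).toGrowth ∈ littleSubmodule w := by
  have e : T (LittleGrowthSpace.monomial v k).toGrowth =
      (g - ∑ n ∈ Finset.range k, (moment μ n : ℂ) • LittleGrowthSpace.monomial w n).toGrowth := by
    refine GrowthSpace.ext' fun z => ?_
    rw [hT, LittleGrowthSpace.sub_apply, hg, LittleGrowthSpace.sum_apply,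
      ← cesaro_monomial_add (v := v) k z]
    simp_rw [LittleGrowthSpace.smul_apply, LittleGrowthSpace.monomial_apply]
    rw [add_sub_cancel_right]
  rw [e]
  exact Subtype.property _

lemma exists_little_of_big {T : GrowthSpace v →L[ℂ] GrowthSpace w} (hT : IsCesaroBig μ T)
    {g : LittleGrowthSpace w} (hg : ∀ z, g z = cesaro μ (fun _ => 1) z) :
    ∃ S : LittleGrowthSpace v →L[ℂ] LittleGrowthSpace w, IsCesaroLittle μ S := by
  set A : LittleGrowthSpace v →L[ℂ] GrowthSpace w :=
    T.comp (LittleGrowthSpace.inclusion v).toContinuousLinearMap with hA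
  have hspan : Submodule.span ℂ (Set.range (LittleGrowthSpace.monomial v)) ≤
      (littleSubmodule w).comap (A : LittleGrowthSpace v →ₗ[ℂ] GrowthSpace w) := by
    rw [Submodule.span_le]
    rintro _ ⟨k, rfl⟩
    exact map_monomial_mem hT hg k
  have hmem : ∀ f, A f ∈ littleSubmodule w := by
    -- The preimage of H_w^0 is a closed subspace containing the monomials, hence everything.
    have := Submodule.topologicalClosure_minimal _ hspan
      (isClosed_littleSubmodule.preimage A.continuous)
    rw [closure_span_monomial] at this
    exact fun f => this (Submodule.mem_top (x := f))
  exact ⟨A.codRestrict (littleSubmodule w) hmem, fun f z => hT f.toGrowth z⟩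

end Cesaro

end CesaroType

end

theorem theorem2p1 (μ : MeasureTheory.Measure (Set.Ico (0 : ℝ) 1))
    [MeasureTheory.IsFiniteMeasure μ] (v w : CesaroType.Weight) :
    (((∃ T : CesaroType.GrowthSpace v →L[ℂ] CesaroType.GrowthSpace w,
          CesaroType.IsCesaroBig μ T) ∧
        ∃ g : CesaroType.LittleGrowthSpace w, ∀ z, g z = CesaroType.cesaro μ (fun _ => 1) z) ↔
      ∃ S : CesaroType.LittleGrowthSpace v →L[ℂ] CesaroType.LittleGrowthSpace w,
        CesaroType.IsCesaroLittle μ S) ∧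
    ∀ (T : CesaroType.GrowthSpace v →L[ℂ] CesaroType.GrowthSpace w)
      (S : CesaroType.LittleGrowthSpace v →L[ℂ] CesaroType.LittleGrowthSpace w),
      CesaroType.IsCesaroBig μ T → CesaroType.IsCesaroLittle μ S →
        (∃ (Jv : StrongDual ℂ (StrongDual ℂ (CesaroType.LittleGrowthSpace v)) ≃ₗᵢ[ℂ]
              CesaroType.GrowthSpace v)
            (Jw : StrongDual ℂ (StrongDual ℂ (CesaroType.LittleGrowthSpace w)) ≃ₗᵢ[ℂ]
              CesaroType.GrowthSpace w),
          CesaroType.IsCanonical Jv ∧ CesaroType.IsCanonical Jw ∧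
            ∀ Φ, Jw (CesaroType.bitranspose S Φ) = T (Jv Φ)) ∧
        ‖T‖ = ‖S‖ := by
  refine ⟨⟨?_, ?_⟩, fun T S hT hS => ⟨⟨CesaroType.canonicalIso v, CesaroType.canonicalIso w,
    fun _ _ => rfl, fun _ _ => rfl, CesaroType.canonicalIso_bitranspose hT hS⟩,
    CesaroType.norm_big_eq_norm_little hT hS⟩⟩
  · rintro ⟨⟨T, hT⟩, g, hg⟩
    exact CesaroType.exists_little_of_big hT hg
  · rintro ⟨S, hS⟩
    exact ⟨CesaroType.exists_big_of_little hS, CesaroType.exists_apply_eq_cesaro_one hS⟩
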